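/- Proposition (energy control of a vibrating string). Let $\omega_0>0$, $K>0$, $\gamma>0$ and $H^*\ge 0$ be real numbers, let $|\cdot|$ be the Euclidean norm on $\mathbb{R}^2$, and for $q,p\in\mathbb{R}^2$ put $$H(q,p)=\tfrac12|p|^2+\tfrac{\omega_0^2}{2}|q|^2+\tfrac{\omega_0^2}{4}K|q|^4 .$$ Consider the system $$\dot q=p,\qquad \dot p=-\omega_0^2\bigl(1+K|q|^2\bigr)q+u,\qquad u=-\gamma\,\mathrm{sign}\bigl(H(q,p)-H^*\bigr)\,p,$$ where $\mathrm{sign}(0)=0$. A solution on $\mathbb{R}_+=[0,\infty)$ is a pair of functions $q,p\colon\mathbb{R}_+\to\mathbb{R}^2$ that are absolutely continuous on every compact interval $[0,b]$ and satisfy the equations for almost every $t\ge 0$. Let $q_0,p_0\in\mathbb{R}^2$ satisfy $|q_0|+|p_0|\ne 0$ and $H(q_0,p_0)\ne H^*$. Then there exists a solution $(q(t),p(t))$ on $\mathbb{R}_+$ with $q(0)=q_0$, $p(0)=p_0$ that is bounded on $\mathbb{R}_+$ and satisfies $H(q(t),p(t))\to H^*$ as $t\to+\infty$. Moreover, if $H^*\neq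 0$, then for this solution there exists $T>0$ such that $H(q(t),p(t))\to H^*$ as $t\to T$ and $H(q(t),p(t))=H^*$ for all $t\ge T$; that is, the energy level is reached (and then kept) in finite time. -/

import Mathlib

open Filter Topology MeasureTheory Set

noncomputable section

/-- The Euclidean plane, in which the displacement and the velocity of the string live. -/
abbrev StringPlane : Type := EuclideanSpace ℝ (Fin 2)

/-- The Hamiltonian `H(q, p)` of the undamped vibrating string. -/
def stringEnergy (ω₀ K : ℝ) (q p : StringPlane) : ℝ :=
  1 / 2 * ‖p‖ ^ 2 + ω₀ ^ 2 / 2 * ‖q‖ ^ 2 + ω₀ ^ 2 / 4 * K * (‖q‖ ^ 2) ^ 2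

/-- The right-hand side of the equation for the velocity under the forcing term `u`. -/
def stringAcceleration (ω₀ K : ℝ) (q u : StringPlane) : StringPlane :=
  -((ω₀ ^ 2 * (1 + K * ‖q‖ ^ 2)) • q) + u

/-- The energy control law `u(q, p) = -γ sign(H(q, p) - H*) p`, where `sign 0 = 0`. -/
def energyFeedback (ω₀ K γ Hstar : ℝ) (q p : StringPlane) : StringPlane :=
  -((γ * Real.sign (stringEnergy ω₀ K q p - Hstar)) • p)

/-- `(q, p)` is a solution on `[0, ∞)` of the string equations closed by the energy control law:
it is absolutely continuous on every `[0, b]` and satisfies the equations for almost all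
`t ≥ 0`. The values at negative times are irrelevant. -/
structure IsClosedLoopStringSolution (ω₀ K γ Hstar : ℝ) (q p : ℝ → StringPlane) : Prop where
  absolutelyContinuous_fst : ∀ b : ℝ, 0 ≤ b → AbsolutelyContinuousOnInterval q 0 b
  absolutelyContinuous_snd : ∀ b : ℝ, 0 ≤ b → AbsolutelyContinuousOnInterval p 0 b
  hasDerivAt_fst : ∀ᵐ t ∂(volume.restrict (Ici (0 : ℝ))), HasDerivAt q (p t) t
  hasDerivAt_snd : ∀ᵐ t ∂(volume.restrict (Ici (0 : ℝ))),
    HasDerivAt p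
      (stringAcceleration ω₀ K (q t) (energyFeedback ω₀ K γ Hstar (q t) (p t))) t

end

/-! As long as H ≠ H*, the feedback is linear damping or antidamping, and H moves monotonically
towards H* at rate γ|p|². It cannot stall at a positive level: with s = ±1 the sign of H - H*, the
function V = sH + ε⟨q, p⟩ satisfies V' ≤ -εH for small ε, yet V stays bounded while H does
(`not_stringEnergy_mem_Icc`).

If H* > 0, the energy would otherwise stay for ever between min(H₀, H*) > 0 and max(H₀, H*), so it
hits H* at a finite time T. Conservative motion continues from there with u = 0, and the glued curve
violates the equations at most at T. If H* = 0, the damped motion itself is the solution.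

The discontinuous law thus only requires smooth fields. Their cubic growth is cut off by a
nonnegative factor, which preserves the monotonicity of H; the relevant motion stays in a sublevel
set where the factor is 1. -/

/-! ### Global integral curves and gluing -/

/-- A bounded Lipschitz vector field has global integral curves. -/
theorem exists_global_integralCurve {E : Type*} [NormedAddCommGroup E] [NormedSpace ℝ E]
    [CompleteSpace E] {G : E → E} {C : ℝ} {L : NNReal} (hC : ∀ x, ‖G x‖ ≤ C)
    (hL : LipschitzWith L G) (x₀ : E) :
    ∃ x : ℝ → E, x 0 = x₀ ∧ ∀ t, HasDerivAt x (G (x t)) t := by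
  have hC0 : 0 ≤ C := (norm_nonneg _).trans (hC x₀)
  -- The bound on `G` is global, so a ball of radius C(n + 1) gives existence on all of [-(n + 1), n
  -- + 1]. Since |t| < ⌈|t|⌉ + 1, each time is interior to some interval.
  have key : ∀ n : ℕ, ∃ x : ℝ → E, x 0 = x₀ ∧
      ∀ t ∈ Ioo (-(n + 1 : ℝ)) (n + 1), HasDerivAt x (G (x t)) t := by
    intro n
    have hn : (0 : ℝ) ≤ n + 1 := by positivity
    have hPL : IsPicardLindelof (fun _ ↦ G) (tmin := -(n + 1 : ℝ)) (tmax := n + 1)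
        ⟨0, by constructor <;> linarith⟩ x₀ (⟨C * (n + 1), by positivity⟩ : NNReal) 0
        ⟨C, hC0⟩ L :=
      IsPicardLindelof.of_time_independent (fun x _ ↦ hC x) hL.lipschitzOnWith
        (by simp; exact le_refl (C * (n + 1)))
    obtain ⟨x, hx0, hx⟩ := hPL.exists_eq_forall_mem_Icc_hasDerivWithinAt₀
    exact ⟨x, hx0, fun t ht ↦
      (hx t (Ioo_subset_Icc_self ht)).hasDerivAt (Icc_mem_nhds ht.1 ht.2)⟩
  choose x hx0 hx using key
  have huniq : ∀ m n : ℕ, m ≤ n → EqOn (x m) (x n) (Ioo (-(m + 1 : ℝ)) (m + 1)) := by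
    intro m n hmn
    have hm : (0 : ℝ) < m + 1 := by positivity
    have hmn' : (m : ℝ) ≤ n := by exact_mod_cast hmn
    refine ODE_solution_unique_of_mem_Ioo (t₀ := 0) (v := fun _ ↦ G) (s := fun _ ↦ univ) (K := L)
      (fun t _ ↦ hL.lipschitzOnWith) ⟨by linarith, hm⟩ (fun t ht ↦ ⟨hx m t ht, trivial⟩)
      (fun t ht ↦ ⟨hx n t ⟨by linarith [ht.1], by linarith [ht.2]⟩, trivial⟩)
      ((hx0 m).trans (hx0 n).symm)
  have hmem : ∀ t : ℝ, t ∈ Ioo (-((⌈|t|⌉₊ : ℝ) + 1)) (⌈|t|⌉₊ + 1) := by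
    intro t
    have := abs_le.1 (Nat.le_ceil |t|)
    constructor <;> linarith
  have hloc : ∀ n : ℕ, EqOn (fun t ↦ x ⌈|t|⌉₊ t) (x n) (Ioo (-(n + 1 : ℝ)) (n + 1)) := by
    intro n t ht
    rcases le_total ⌈|t|⌉₊ n with h | h
    · exact huniq _ _ h (hmem t)
    · exact (huniq _ _ h ht).symm
  refine ⟨fun t ↦ x ⌈|t|⌉₊ t, by simp [hx0], fun t ↦ ?_⟩
  exact (hx _ t (hmem t)).congr_of_eventuallyEq
    ((hloc ⌈|t|⌉₊).eventuallyEq_of_mem (Ioo_mem_nhds (hmem t).1 (hmem t).2))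

/-- Global integral curves, uniformly Lipschitz in time, of a `C¹` field truncated outside a large
ball. -/
theorem exists_truncated_integralCurve {E : Type*} [NormedAddCommGroup E] [NormedSpace ℝ E]
    [FiniteDimensional ℝ E] {F : E → E} (hF : ContDiff ℝ 1 F) (R : ℝ) (x₀ : E) :
    ∃ (x : ℝ → E) (χ : ℝ → ℝ) (C : NNReal), x 0 = x₀ ∧ LipschitzWith C x ∧ (∀ t, 0 ≤ χ t) ∧
      (∀ t, ‖x t‖ ≤ R → χ t = 1) ∧ ∀ t, HasDerivAt x (χ t • F (x t)) t := by
  have : CompleteSpace E := FiniteDimensional.complete ℝ E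
  let φ : ContDiffBump (0 : E) := ⟨|R| + 1, |R| + 2, by positivity, by linarith⟩
  have hsmooth : ContDiff ℝ 1 (fun y ↦ φ y • F y) := φ.contDiff.smul hF
  have hsupp : HasCompactSupport (fun y ↦ φ y • F y) := φ.hasCompactSupport.smul_right
  obtain ⟨L, hL⟩ := hsmooth.lipschitzWith_of_hasCompactSupport hsupp one_ne_zero
  obtain ⟨C, hC⟩ := hsmooth.continuous.bounded_above_of_compact_support hsupp
  obtain ⟨x, hx0, hx⟩ := exists_global_integralCurve hC hL x₀
  refine ⟨x, fun t ↦ φ (x t), ⟨C, (norm_nonneg _).trans (hC x₀)⟩, hx0, ?_, fun t ↦ φ.nonneg,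
    fun t ht ↦ φ.one_of_mem_closedBall ?_, hx⟩
  · refine lipschitzWith_of_nnnorm_deriv_le (fun t ↦ (hx t).differentiableAt) fun t ↦ ?_
    rw [(hx t).deriv]
    exact hC (x t)
  · rw [mem_closedBall_zero_iff]
    exact ht.trans ((le_abs_self R).trans (by simp [φ]))

/-- Concatenation of two Lipschitz curves at time `T`. -/
theorem exists_lipschitzWith_concat {E : Type*} [NormedAddCommGroup E] {f g : ℝ → E}
    {C D : NNReal} (hf : LipschitzWith C f) (hg : LipschitzWith D g) {T : ℝ} (h : g 0 = f T) :
    ∃ (x : ℝ → E) (B : NNReal), LipschitzWith B x ∧ (∀ t ≤ T, x t = f t) ∧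
      ∀ t, T ≤ t → x t = g (t - T) := by
  have h1 : LipschitzWith 1 fun t : ℝ ↦ min t T := LipschitzWith.id.min_const T
  have h2 : LipschitzWith 1 fun t : ℝ ↦ max (t - T) 0 := by
    simpa using ((LipschitzWith.id (α := ℝ)).sub (LipschitzWith.const T)).max_const 0
  -- Clamping the times replaces a case split, so the Lipschitz bound follows from sums and
  -- compositions.
  refine ⟨fun t ↦ f (min t T) + g (max (t - T) 0) - f T, _,
    ((hf.comp h1).add (hg.comp h2)).sub (LipschitzWith.const (f T)), fun t ht ↦ ?_,
    fun t ht ↦ ?_⟩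
  · simp [min_eq_left ht, max_eq_right (sub_nonpos.2 ht), h]
  · simp [min_eq_right ht, max_eq_left (sub_nonneg.2 ht)]

/-! ### Energy balance and the Lyapunov function -/

section

variable {ω₀ K c : ℝ}

theorem continuous_stringEnergy : Continuous fun x : StringPlane × StringPlane ↦
    stringEnergy ω₀ K x.1 x.2 := by
  unfold stringEnergy; fun_prop

theorem contDiff_stringField : ContDiff ℝ 1 fun x : StringPlane × StringPlane ↦
    (x.2, stringAcceleration ω₀ K x.1 (-(c • x.2))) := by
  unfold stringAcceleration
  have : ContDiff ℝ 1 fun x : StringPlane × StringPlane ↦ ‖x.1‖ ^ 2 := contDiff_fst.norm_sq ℝ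
  fun_prop

/-- The conservative forces cancel, leaving the power of the friction; the cutoff `χ` merely
rescales it. -/
theorem hasDerivAt_stringEnergy {q p : ℝ → StringPlane} {χ t : ℝ}
    (hq : HasDerivAt q (χ • p t) t)
    (hp : HasDerivAt p (χ • stringAcceleration ω₀ K (q t) (-(c • p t))) t) :
    HasDerivAt (fun t ↦ stringEnergy ω₀ K (q t) (p t)) (-(c * χ * ‖p t‖ ^ 2)) t := by
  unfold stringEnergy
  have hq2 := hq.norm_sq
  have := ((hp.norm_sq.const_mul (1 / 2)).add (hq2.const_mul (ω₀ ^ 2 / 2))).add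
    ((hq2.pow 2).const_mul (ω₀ ^ 2 / 4 * K))
  refine this.congr_deriv ?_
  simp only [stringAcceleration, inner_smul_right, inner_add_right, inner_neg_right,
    real_inner_self_eq_norm_sq, real_inner_comm (q t) (p t)]
  rw [real_inner_comm]
  ring

theorem hasDerivAt_inner_string {q p : ℝ → StringPlane} {t : ℝ}
    (hq : HasDerivAt q (p t) t)
    (hp : HasDerivAt p (stringAcceleration ω₀ K (q t) (-(c • p t))) t) :
    HasDerivAt (fun t ↦ inner ℝ (q t) (p t))
      (‖p t‖ ^ 2 - ω₀ ^ 2 * (1 + K * ‖q t‖ ^ 2) * ‖q t‖ ^ 2 - c * inner ℝ (q t) (p t)) t := by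
  refine (hq.inner ℝ hp).congr_deriv ?_
  simp only [stringAcceleration, inner_smul_right, inner_add_right, inner_neg_right,
    real_inner_self_eq_norm_sq]
  ring

theorem stringEnergy_nonneg (hK : 0 < K) (q p : StringPlane) : 0 ≤ stringEnergy ω₀ K q p := by
  unfold stringEnergy; positivity

theorem stringEnergy_pos (hω₀ : 0 < ω₀) (hK : 0 < K) {q p : StringPlane}
    (h : ‖q‖ + ‖p‖ ≠ 0) : 0 < stringEnergy ω₀ K q p := by
  unfold stringEnergy
  by_cases hq : ‖q‖ = 0
  · have : ‖p‖ ≠ 0 := by simpa [hq] using h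
    positivity
  · positivity

theorem sq_norm_le_of_stringEnergy_le (hω₀ : 0 < ω₀) (hK : 0 < K) {q p : StringPlane} {M : ℝ}
    (h : stringEnergy ω₀ K q p ≤ M) : ‖q‖ ^ 2 ≤ 2 * M / ω₀ ^ 2 ∧ ‖p‖ ^ 2 ≤ 2 * M := by
  unfold stringEnergy at h
  have h1 : 0 ≤ ω₀ ^ 2 / 4 * K * (‖q‖ ^ 2) ^ 2 := by positivity
  have h2 : 0 ≤ ω₀ ^ 2 / 2 * ‖q‖ ^ 2 := by positivity
  have h3 : 0 ≤ ‖p‖ ^ 2 := by positivity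
  refine ⟨?_, by linarith⟩
  rw [le_div_iff₀ (by positivity)]
  linarith

theorem exists_norm_le_of_stringEnergy_le (hω₀ : 0 < ω₀) (hK : 0 < K) (M : ℝ) :
    ∃ R : ℝ, ∀ q p : StringPlane, stringEnergy ω₀ K q p ≤ M → ‖(q, p)‖ ≤ R := by
  refine ⟨max √(2 * M / ω₀ ^ 2) √(2 * M), fun q p h ↦ ?_⟩
  obtain ⟨h1, h2⟩ := sq_norm_le_of_stringEnergy_le hω₀ hK h
  exact max_le_max (Real.le_sqrt_of_sq_le h1) (Real.le_sqrt_of_sq_le h2)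

/-- Under linear damping (`s = 1`) or antidamping (`s = -1`) the energy does not stay for ever in a
compact interval of positive numbers. -/
theorem not_stringEnergy_mem_Icc (hω₀ : 0 < ω₀) (hK : 0 < K) {γ s : ℝ} (hγ : 0 < γ)
    (hs : s ^ 2 = 1) {q p : ℝ → StringPlane} {m M : ℝ} (hm : 0 < m)
    (hq : ∀ t, 0 ≤ t → HasDerivAt q (p t) t)
    (hp : ∀ t, 0 ≤ t → HasDerivAt p (stringAcceleration ω₀ K (q t) (-((s * γ) • p t))) t)
    (hH : ∀ t, 0 ≤ t → stringEnergy ω₀ K (q t) (p t) ∈ Icc m M) : False := by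
  -- Young's inequality on γ|q||p| leaves the coefficient εb on |p|². The choice εb = γ/2 lets half
  -- of the damping absorb it; the other half dominates ε|p|²/2 because ε ≤ γ/2.
  set b := 1 + γ ^ 2 / (2 * ω₀ ^ 2) with hb
  have hb0 : 0 < b := by positivity
  set ε := γ / (2 * b) with hε
  have hε0 : 0 < ε := by positivity
  have hεb : ε * b = γ / 2 := by rw [hε]; field_simp
  have hεγ : ε ≤ γ / 2 := by
    rw [← hεb]
    have : 0 ≤ γ ^ 2 / (2 * ω₀ ^ 2) := by positivity
    exact le_mul_of_one_le_right hε0.le (by linarith)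
  let V : ℝ → ℝ := fun t ↦ s * stringEnergy ω₀ K (q t) (p t) + ε * inner ℝ (q t) (p t)
  have hV : ∀ t, 0 ≤ t → HasDerivAt V (s * -(s * γ * 1 * ‖p t‖ ^ 2) +
      ε * (‖p t‖ ^ 2 - ω₀ ^ 2 * (1 + K * ‖q t‖ ^ 2) * ‖q t‖ ^ 2 -
        s * γ * inner ℝ (q t) (p t))) t := fun t ht ↦
    ((hasDerivAt_stringEnergy (χ := 1) (by simpa using hq t ht)
      (by simpa using hp t ht)).const_mul s).add
      ((hasDerivAt_inner_string (hq t ht) (hp t ht)).const_mul ε)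
  have hs1 : |s| = 1 := by rw [← sq_eq_sq₀ (abs_nonneg s) zero_le_one, sq_abs, hs, one_pow]
  have hin : ∀ t, |inner ℝ (q t) (p t)| ≤ ‖q t‖ * ‖p t‖ := fun t ↦ abs_real_inner_le_norm _ _
  have hV' : ∀ t, 0 ≤ t → deriv V t ≤ -(ε * m) := by
    intro t ht
    rw [(hV t ht).deriv]
    have h1 : -(s * γ * inner ℝ (q t) (p t)) ≤ γ * (‖q t‖ * ‖p t‖) := by
      refine (neg_le_abs _).trans ?_
      rw [abs_mul, abs_mul, hs1, one_mul, abs_of_pos hγ]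
      exact mul_le_mul_of_nonneg_left (hin t) hγ.le
    have h2 : γ * (‖q t‖ * ‖p t‖) ≤ ω₀ ^ 2 / 2 * ‖q t‖ ^ 2 + γ ^ 2 / (2 * ω₀ ^ 2) * ‖p t‖ ^ 2 := by
      have : ω₀ ^ 2 / 2 * ‖q t‖ ^ 2 + γ ^ 2 / (2 * ω₀ ^ 2) * ‖p t‖ ^ 2 - γ * (‖q t‖ * ‖p t‖)
        = (ω₀ * ‖q t‖ - γ / ω₀ * ‖p t‖) ^ 2 / 2 := by field_simp; ring
      linarith [show 0 ≤ (ω₀ * ‖q t‖ - γ / ω₀ * ‖p t‖) ^ 2 / 2 by positivity]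
    have h3 := (hH t ht).1
    unfold stringEnergy at h3
    have h4 : ε * (ω₀ ^ 2 / 4 * K * (‖q t‖ ^ 2) ^ 2) * 3 ≥ 0 := by positivity
    have h5 : (γ / 2 - ε / 2) * ‖p t‖ ^ 2 ≥ 0 := mul_nonneg (by linarith) (by positivity)
    have h6 := mul_le_mul_of_nonneg_left h3 hε0.le
    have h7 := mul_le_mul_of_nonneg_left (h1.trans h2) hε0.le
    have h8 : ε * ‖p t‖ ^ 2 + ε * (γ ^ 2 / (2 * ω₀ ^ 2) * ‖p t‖ ^ 2) = γ / 2 * ‖p t‖ ^ 2 := by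
      rw [← hεb, hb]; ring
    have h9 : s * -(s * γ * 1 * ‖p t‖ ^ 2) = -(γ * ‖p t‖ ^ 2) := by
      linear_combination (-(γ * ‖p t‖ ^ 2)) * hs
    rw [h9]
    nlinarith only [h4, h5, h6, h7, h8]
  obtain ⟨R, hR⟩ := exists_norm_le_of_stringEnergy_le hω₀ hK M
  have hbd : ∀ t, 0 ≤ t → |V t| ≤ M + ε * (R * R) := by
    intro t ht
    have hn := hR _ _ (hH t ht).2
    have hqR : ‖q t‖ ≤ R := (norm_fst_le (q t, p t)).trans hn
    have hpR : ‖p t‖ ≤ R := (norm_snd_le (q t, p t)).trans hn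
    refine (abs_add_le _ _).trans (add_le_add ?_ ?_)
    · rw [abs_mul, hs1, one_mul, abs_of_nonneg (stringEnergy_nonneg hK _ _)]
      exact (hH t ht).2
    · rw [abs_mul, abs_of_pos hε0]
      have := mul_le_mul hqR hpR (norm_nonneg _) ((norm_nonneg _).trans hqR)
      exact mul_le_mul_of_nonneg_left ((hin t).trans this) hε0.le
  have hdec : ∀ t, 0 ≤ t → V t - V 0 ≤ -(ε * m) * (t - 0) := fun t ht ↦
    (convex_Ici (0 : ℝ)).image_sub_le_mul_sub_of_deriv_le
      (fun x hx ↦ (hV x hx).continuousAt.continuousWithinAt)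
      (fun x hx ↦ (hV x (interior_subset hx)).differentiableAt.differentiableWithinAt)
      (fun x hx ↦ hV' x (interior_subset hx)) 0 self_mem_Ici t ht ht
  set B := M + ε * (R * R)
  have hB : 0 ≤ B := (abs_nonneg _).trans (hbd 0 le_rfl)
  -- By this time V has dropped by at least 2B + 1, impossible when |V| ≤ B.
  have ht : 0 ≤ (2 * B + 1) / (ε * m) := by positivity
  have h1 := hdec _ ht
  have h2 : -(ε * m) * ((2 * B + 1) / (ε * m) - 0) = -(2 * B + 1) := by field_simp; ring
  linarith [abs_le.1 (hbd _ ht), abs_le.1 (hbd 0 le_rfl)]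

end

/-! ### Truncated motions and the notion of solution -/

/-- Linearly damped (`0 ≤ c`) or antidamped (`c ≤ 0`) motion of the string, truncated at high
energies. -/
theorem exists_truncated_string {ω₀ K : ℝ} (hω₀ : 0 < ω₀) (hK : 0 < K) (c M : ℝ)
    (q₀ p₀ : StringPlane) :
    ∃ (q p : ℝ → StringPlane) (χ : ℝ → ℝ) (C : NNReal), q 0 = q₀ ∧ p 0 = p₀ ∧
      LipschitzWith C (fun t ↦ (q t, p t)) ∧
      (∀ t, HasDerivAt (fun t ↦ stringEnergy ω₀ K (q t) (p t)) (-(c * χ t * ‖p t‖ ^ 2)) t) ∧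
      (∀ t, 0 ≤ χ t) ∧
      ∀ t, stringEnergy ω₀ K (q t) (p t) ≤ M → HasDerivAt q (p t) t ∧
        HasDerivAt p (stringAcceleration ω₀ K (q t) (-(c • p t))) t := by
  obtain ⟨R, hR⟩ := exists_norm_le_of_stringEnergy_le hω₀ hK M
  obtain ⟨x, χ, C, hx0, hlip, hχ, hχ1, hx⟩ :=
    exists_truncated_integralCurve (contDiff_stringField (ω₀ := ω₀) (K := K) (c := c)) R (q₀, p₀)
  have hq : ∀ t, HasDerivAt (fun t ↦ (x t).1) (χ t • (x t).2) t := fun t ↦ (hx t).fst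
  have hp : ∀ t, HasDerivAt (fun t ↦ (x t).2)
    (χ t • stringAcceleration ω₀ K (x t).1 (-(c • (x t).2))) t := fun t ↦ (hx t).snd
  refine ⟨fun t ↦ (x t).1, fun t ↦ (x t).2, χ, C, by simp [hx0], by simp [hx0], hlip,
    fun t ↦ hasDerivAt_stringEnergy (hq t) (hp t), hχ, fun t ht ↦ ?_⟩
  have h1 := hχ1 t (hR _ _ ht)
  exact ⟨by simpa [h1] using hq t, by simpa [h1] using hp t⟩

theorem isBounded_image_of_stringEnergy_le {ω₀ K : ℝ} (hω₀ : 0 < ω₀) (hK : 0 < K) {M : ℝ}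
    {q p : ℝ → StringPlane} {S : Set ℝ} (h : ∀ t ∈ S, stringEnergy ω₀ K (q t) (p t) ≤ M) :
    Bornology.IsBounded ((fun t ↦ (q t, p t)) '' S) := by
  obtain ⟨R, hR⟩ := exists_norm_le_of_stringEnergy_le hω₀ hK M
  refine isBounded_iff_forall_norm_le.2 ⟨R, ?_⟩
  rintro _ ⟨t, ht, rfl⟩
  exact hR _ _ (h t ht)

/-- The exempted instant `T` is the switching time, a null set. -/
theorem isClosedLoopStringSolution_of_lipschitzWith {ω₀ K γ Hstar T : ℝ} {q p : ℝ → StringPlane}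
    {C : NNReal} (hlip : LipschitzWith C (fun t ↦ (q t, p t)))
    (h : ∀ t, 0 ≤ t → t ≠ T → HasDerivAt q (p t) t ∧ HasDerivAt p
      (stringAcceleration ω₀ K (q t) (energyFeedback ω₀ K γ Hstar (q t) (p t))) t) :
    IsClosedLoopStringSolution ω₀ K γ Hstar q p := by
  have hae : ∀ᵐ t ∂(volume.restrict (Ici (0 : ℝ))), 0 ≤ t ∧ t ≠ T :=
    (ae_restrict_mem measurableSet_Ici).and (ae_restrict_of_ae (Measure.ae_ne volume T))
  exact
    { absolutelyContinuous_fst := fun b _ ↦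
        ((LipschitzWith.prod_fst.comp hlip).lipschitzOnWith).absolutelyContinuousOnInterval
      absolutelyContinuous_snd := fun b _ ↦
        ((LipschitzWith.prod_snd.comp hlip).lipschitzOnWith).absolutelyContinuousOnInterval
      hasDerivAt_fst := hae.mono fun t ht ↦ (h t ht.1 ht.2).1
      hasDerivAt_snd := hae.mono fun t ht ↦ (h t ht.1 ht.2).2 }

/-! ### Reaching the target level -/

/-- A continuous function that is nonzero on an interval keeps its sign. -/
theorem mul_sub_pos_of_forall_ne {f : ℝ → ℝ} (hf : Continuous f) {s a t : ℝ} (hs : s ≠ 0)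
    (ht : 0 ≤ t) (h0 : 0 < s * (f 0 - a)) (hne : ∀ u ∈ Icc 0 t, f u ≠ a) :
    0 < s * (f t - a) := by
  by_contra! hle
  have hcont : ContinuousOn (fun u ↦ s * (f u - a)) (Icc 0 t) := by fun_prop
  obtain ⟨u, hu, hu0⟩ := intermediate_value_Icc' ht hcont ⟨hle, h0.le⟩
  exact hne u hu (sub_eq_zero.1 ((mul_eq_zero.1 hu0).resolve_left hs))

theorem exists_solution_of_target_zero {ω₀ K γ : ℝ} (hω₀ : 0 < ω₀) (hK : 0 < K) (hγ : 0 < γ)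
    (q₀ p₀ : StringPlane) :
    ∃ q p : ℝ → StringPlane, q 0 = q₀ ∧ p 0 = p₀ ∧
      IsClosedLoopStringSolution ω₀ K γ 0 q p ∧
      Bornology.IsBounded ((fun t ↦ (q t, p t)) '' Ici (0 : ℝ)) ∧
      Tendsto (fun t ↦ stringEnergy ω₀ K (q t) (p t)) atTop (𝓝 0) := by
  obtain ⟨q, p, χ, C, hq0, hp0, hlip, hE, hχ, hode⟩ :=
    exists_truncated_string hω₀ hK γ (stringEnergy ω₀ K q₀ p₀) q₀ p₀
  have hanti : Antitone fun t ↦ stringEnergy ω₀ K (q t) (p t) :=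
    antitone_of_hasDerivAt_nonpos hE fun t ↦ by have := hχ t; exact neg_nonpos.2 (by positivity)
  have hle : ∀ t, 0 ≤ t → stringEnergy ω₀ K (q t) (p t) ≤ stringEnergy ω₀ K q₀ p₀ := by
    intro t ht
    simpa [hq0, hp0] using hanti ht
  refine ⟨q, p, hq0, hp0, isClosedLoopStringSolution_of_lipschitzWith (T := 0) hlip fun t ht _ ↦ ?_,
    isBounded_image_of_stringEnergy_le hω₀ hK hle, ?_⟩
  · obtain ⟨h1, h2⟩ := hode t (hle t ht)
    refine ⟨h1, ?_⟩
    convert h2 using 2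
    -- The sign can differ from 1 only at zero energy; there p = 0 and both laws vanish.
    by_cases hp : p t = 0
    · simp [energyFeedback, hp]
    · have : 0 < stringEnergy ω₀ K (q t) (p t) :=
        stringEnergy_pos hω₀ hK (by have := norm_pos_iff.2 hp; positivity)
      simp [energyFeedback, Real.sign_of_pos this]
  · refine tendsto_order.2 ⟨fun a ha ↦ Eventually.of_forall fun t ↦
      ha.trans_le (stringEnergy_nonneg hK _ _), fun a ha ↦ ?_⟩
    -- By monotonicity, one passage below `a` suffices.
    have : ∃ t, 0 ≤ t ∧ stringEnergy ω₀ K (q t) (p t) < a := by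
      by_contra! hcon
      exact not_stringEnergy_mem_Icc (s := 1) hω₀ hK hγ (one_pow 2) ha
        (fun t ht ↦ (hode t (hle t ht)).1) (fun t ht ↦ by simpa using (hode t (hle t ht)).2)
        fun t ht ↦ ⟨hcon t ht, hle t ht⟩
    obtain ⟨t, -, ht⟩ := this
    filter_upwards [eventually_ge_atTop t] with u hu using (hanti hu).trans_lt ht

/-- The energy reaches a positive target level in finite time. -/
theorem exists_solution_until_target {ω₀ K γ Hstar : ℝ} (hω₀ : 0 < ω₀) (hK : 0 < K) (hγ : 0 < γ)
    (hHstar : 0 < Hstar) {q₀ p₀ : StringPlane} (hne : ‖q₀‖ + ‖p₀‖ ≠ 0)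
    (hH : stringEnergy ω₀ K q₀ p₀ ≠ Hstar) :
    ∃ (q p : ℝ → StringPlane) (T M : ℝ) (C : NNReal), q 0 = q₀ ∧ p 0 = p₀ ∧
      LipschitzWith C (fun t ↦ (q t, p t)) ∧ 0 < T ∧ stringEnergy ω₀ K (q T) (p T) = Hstar ∧
      ∀ t ∈ Ico 0 T, stringEnergy ω₀ K (q t) (p t) ≤ M ∧ HasDerivAt q (p t) t ∧ HasDerivAt p
        (stringAcceleration ω₀ K (q t) (energyFeedback ω₀ K γ Hstar (q t) (p t))) t := by
  set H₀ := stringEnergy ω₀ K q₀ p₀ with hH₀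
  have hH₀pos : 0 < H₀ := stringEnergy_pos hω₀ hK hne
  obtain ⟨s, hs, hs0⟩ : ∃ s : ℝ, (s = 1 ∨ s = -1) ∧ 0 < s * (H₀ - Hstar) := by
    rcases hH.lt_or_gt with h | h
    · exact ⟨-1, Or.inr rfl, by linarith⟩
    · exact ⟨1, Or.inl rfl, by linarith⟩
  have hs2 : s ^ 2 = 1 := by rcases hs with rfl | rfl <;> norm_num
  have hsne : s ≠ 0 := by rintro rfl; simp at hs2
  obtain ⟨q, p, χ, C, hq0, hp0, hlip, hE, hχ, hode⟩ :=
    exists_truncated_string hω₀ hK (s * γ) (max H₀ Hstar) q₀ p₀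
  set H : ℝ → ℝ := fun t ↦ stringEnergy ω₀ K (q t) (p t) with hHdef
  have hH0 : H 0 = H₀ := by simp only [hHdef, hq0, hp0, hH₀]
  have hcont : Continuous H := continuous_iff_continuousAt.2 fun t ↦ (hE t).continuousAt
  have hanti : Antitone fun t ↦ s * H t := by
    refine antitone_of_hasDerivAt_nonpos (fun t ↦ (hE t).const_mul s) fun t ↦ ?_
    have h1 : s * -(s * γ * χ t * ‖p t‖ ^ 2) = -(γ * χ t * ‖p t‖ ^ 2) := by
      linear_combination (-(γ * χ t * ‖p t‖ ^ 2)) * hs2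
    have := hχ t
    rw [h1]
    exact neg_nonpos.2 (by positivity)
  have hmem : ∀ t, 0 ≤ t → 0 < s * (H t - Hstar) →
      H t ∈ Icc (min H₀ Hstar) (max H₀ Hstar) := by
    intro t ht hpos
    have h1 : s * H t ≤ s * H₀ := by
      rw [← hH0]
      exact hanti ht
    rcases hs with rfl | rfl
    · exact ⟨(min_le_right _ _).trans (by linarith), le_max_of_le_left (by linarith)⟩
    · exact ⟨(min_le_left _ _).trans (by linarith), le_max_of_le_right (by linarith)⟩
  have hpos : ∀ t, 0 ≤ t → (∀ u ∈ Icc 0 t, H u ≠ Hstar) → 0 < s * (H t - Hstar) := fun t ht hu ↦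
    mul_sub_pos_of_forall_ne hcont hsne ht (by rwa [hH0]) hu
  obtain ⟨t₁, ht₁, hHt₁⟩ : ∃ t, 0 ≤ t ∧ H t = Hstar := by
    by_contra! hcon
    have hall : ∀ t, 0 ≤ t → H t ∈ Icc (min H₀ Hstar) (max H₀ Hstar) := fun t ht ↦
      hmem t ht (hpos t ht fun u hu ↦ hcon u hu.1)
    exact not_stringEnergy_mem_Icc hω₀ hK hγ hs2 (lt_min hH₀pos hHstar)
      (fun t ht ↦ (hode t (hall t ht).2).1) (fun t ht ↦ (hode t (hall t ht).2).2) hall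
  -- The first hitting time: before it the sign of H - H* is constantly `s`.
  obtain ⟨T, ⟨⟨hT0, hTt⟩, hHT⟩, hTmin⟩ :=
    (isCompact_Icc.inter_right (isClosed_singleton.preimage hcont)).exists_isLeast
      (⟨t₁, ⟨ht₁, le_rfl⟩, hHt₁⟩ : (Icc 0 t₁ ∩ H ⁻¹' {Hstar}).Nonempty)
  have hTpos : 0 < T := hT0.lt_of_ne fun h ↦ hH (by rw [← hH0, h]; exact hHT)
  refine ⟨q, p, T, max H₀ Hstar, C, hq0, hp0, hlip, hTpos, hHT, fun t ht ↦ ?_⟩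
  have hp := hpos t ht.1 fun u hu hHu ↦
    (hu.2.trans_lt ht.2).not_ge (hTmin ⟨⟨hu.1, (hu.2.trans ht.2.le).trans hTt⟩, hHu⟩)
  have hle := (hmem t ht.1 hp).2
  refine ⟨hle, (hode t hle).1, ?_⟩
  have hsign : Real.sign (stringEnergy ω₀ K (q t) (p t) - Hstar) = s := by
    change 0 < s * (stringEnergy ω₀ K (q t) (p t) - Hstar) at hp
    rcases hs with rfl | rfl
    · exact Real.sign_of_pos (by linarith)
    · exact Real.sign_of_neg (by linarith)
  simpa only [energyFeedback, hsign, mul_comm γ s] using (hode t hle).2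

/-! ### Keeping the level, and the main theorem -/

/-- The conservative motion of the string at a given energy level. -/
theorem exists_conservative_string {ω₀ K : ℝ} (hω₀ : 0 < ω₀) (hK : 0 < K) (q₀ p₀ : StringPlane) :
    ∃ (q p : ℝ → StringPlane) (C : NNReal), q 0 = q₀ ∧ p 0 = p₀ ∧
      LipschitzWith C (fun t ↦ (q t, p t)) ∧
      ∀ t, stringEnergy ω₀ K (q t) (p t) = stringEnergy ω₀ K q₀ p₀ ∧ HasDerivAt q (p t) t ∧
        HasDerivAt p (stringAcceleration ω₀ K (q t) 0) t := by
  obtain ⟨q, p, χ, C, hq0, hp0, hlip, hE, -, hode⟩ :=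
    exists_truncated_string hω₀ hK 0 (stringEnergy ω₀ K q₀ p₀) q₀ p₀
  have hconst : ∀ t, stringEnergy ω₀ K (q t) (p t) = stringEnergy ω₀ K q₀ p₀ := by
    intro t
    rw [is_const_of_deriv_eq_zero (fun t ↦ (hE t).differentiableAt)
      (fun t ↦ (hE t).deriv.trans (by ring)) t 0, hq0, hp0]
  exact ⟨q, p, C, hq0, hp0, hlip, fun t ↦
    ⟨hconst t, (hode t (hconst t).le).1, by simpa using (hode t (hconst t).le).2⟩⟩

theorem mainTheorem5 (ω₀ K γ Hstar : ℝ) (hω₀ : 0 < ω₀) (hK : 0 < K) (hγ : 0 < γ)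
    (hHstar : 0 ≤ Hstar) (q₀ p₀ : StringPlane) (hne : ‖q₀‖ + ‖p₀‖ ≠ 0)
    (hH : stringEnergy ω₀ K q₀ p₀ ≠ Hstar) :
    ∃ q p : ℝ → StringPlane,
      q 0 = q₀ ∧ p 0 = p₀ ∧
      IsClosedLoopStringSolution ω₀ K γ Hstar q p ∧
      Bornology.IsBounded ((fun t => (q t, p t)) '' Ici (0 : ℝ)) ∧
      Tendsto (fun t => stringEnergy ω₀ K (q t) (p t)) atTop (𝓝 Hstar) ∧
      (Hstar ≠ 0 → ∃ T : ℝ, 0 < T ∧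
        Tendsto (fun t => stringEnergy ω₀ K (q t) (p t)) (𝓝 T) (𝓝 Hstar) ∧
        ∀ t : ℝ, T ≤ t → stringEnergy ω₀ K (q t) (p t) = Hstar) := by
  rcases hHstar.eq_or_lt with rfl | hHpos
  · obtain ⟨q, p, h1, h2, h3, h4, h5⟩ := exists_solution_of_target_zero hω₀ hK hγ q₀ p₀
    exact ⟨q, p, h1, h2, h3, h4, h5, fun h ↦ (h rfl).elim⟩
  obtain ⟨q₁, p₁, T, M, C₁, hq0, hp0, hlip₁, hT, hHT, h₁⟩ :=
    exists_solution_until_target hω₀ hK hγ hHpos hne hH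
  obtain ⟨q₂, p₂, C₂, hqT, hpT, hlip₂, h₂⟩ := exists_conservative_string hω₀ hK (q₁ T) (p₁ T)
  obtain ⟨x, C, hlip, hleft, hright⟩ :=
    exists_lipschitzWith_concat hlip₁ hlip₂ (T := T) (by simp [hqT, hpT])
  have hafter : ∀ t, T ≤ t → stringEnergy ω₀ K (x t).1 (x t).2 = Hstar := fun t ht ↦ by
    rw [hright t ht, (h₂ _).1, hHT]
  have hle : ∀ t ∈ Ici (0 : ℝ), stringEnergy ω₀ K (x t).1 (x t).2 ≤ max M Hstar := by
    intro t ht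
    rcases lt_or_ge t T with htT | htT
    · rw [hleft t htT.le]
      exact le_max_of_le_left (h₁ t ⟨ht, htT⟩).1
    · exact (hafter t htT).trans_le (le_max_right _ _)
  refine ⟨fun t ↦ (x t).1, fun t ↦ (x t).2, by simp [hleft 0 hT.le, hq0],
    by simp [hleft 0 hT.le, hp0],
    isClosedLoopStringSolution_of_lipschitzWith (T := T) hlip fun t ht htT ↦ ?_,
    isBounded_image_of_stringEnergy_le hω₀ hK hle,
    tendsto_const_nhds.congr' ?_, fun _ ↦ ⟨T, hT, ?_, hafter⟩⟩
  · rcases htT.lt_or_gt with htT | htT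
    · obtain ⟨-, hq, hp⟩ := h₁ t ⟨ht, htT⟩
      have hev : ∀ᶠ u in 𝓝 t, x u = (q₁ u, p₁ u) :=
        (eventually_lt_nhds htT).mono fun u hu ↦ hleft u hu.le
      simp only [hleft t htT.le]
      exact ⟨hq.congr_of_eventuallyEq (hev.mono fun u hu ↦ by simp [hu]),
        hp.congr_of_eventuallyEq (hev.mono fun u hu ↦ by simp [hu])⟩
    · obtain ⟨hE, hq, hp⟩ := h₂ (t - T)
      have hev : ∀ᶠ u in 𝓝 t, x u = (q₂ (u - T), p₂ (u - T)) :=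
        (eventually_gt_nhds htT).mono fun u hu ↦ hright u hu.le
      -- On the target level the sign is 0, so the closed loop is the conservative system.
      simp only [hright t htT.le, energyFeedback, hE, hHT, sub_self, Real.sign_zero, mul_zero,
        zero_smul, neg_zero]
      exact ⟨(hq.comp_sub_const t T).congr_of_eventuallyEq (hev.mono fun u hu ↦ by simp [hu]),
        (hp.comp_sub_const t T).congr_of_eventuallyEq (hev.mono fun u hu ↦ by simp [hu])⟩
  · filter_upwards [eventually_ge_atTop T] with t ht using (hafter t ht).symm
  · have := (continuous_stringEnergy (ω₀ := ω₀) (K := K)).comp hlip.continuous |>.tendsto T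
    rwa [Function.comp_apply, hafter T le_rfl] at this
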